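/- For a finite graph $H$ let $m_2(H)$ be the maximum of $\frac{e(F)-1}{v(F)-2}$ over all subgraphs $F\subseteq H$ with $v(F)\ge 3$. Let $G(n,p)$ be the binomial random graph on $n$ labelled vertices with edge probability $p$; an event holds with high probability (whp) if its probability tends to $1$ as $n\to\infty$. A graph is $H$-free if it contains no (not necessarily induced) copy of $H$; $\delta(G)$ and $\chi(G)$ denote the minimum degree and the chromatic number of $G$. For a function $p=p(n)\in[0,1]$ define the chromatic threshold $$\delta_\chi(H,p):=\inf\Big\{d>0:\ \exists\, C>0 \text{ such that whp every $H$-free spanning subgraph } G\subseteq G(n,p)\text{ with }\delta(G)\ge dpn\text{ satisfies }\chi(G)\le C\Big\}.$$ Let $H$ be a finite graph with at least two edges (so that $m_2(H)$ is defined and positive), and let $p=p(n)\in[0,1]$ satisfy $\frac{\log n}{n}=o(p)$ and $p=o\big(n^{-1/m_2(H)}\big)$ as $n\to\infty$. Then: 1. for every $\gamma>0$, with high probability there exists an $H$-free spanning subgraph $G\subseteq G(n,p)$ with $$\delta(G)\ge(1-2\gamma)pn\qquad\text{and}\qquad\chi(G)\ge\tfrac12\gamma^{-1/2};$$ 2.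 $\delta_\chi(H,p)=1$. -/

import Mathlib

open Filter Topology Asymptotics

namespace SimpleGraph

/-- The 2-density `m₂(H)`: the maximum of `(e(F) - 1) / (v(F) - 2)` over all subgraphs `F` of the
finite graph `H` with `v(F) ≥ 3`. (It is a maximum over a finite set of reals, which is nonempty
as soon as `H` has at least three vertices.) -/
noncomputable def twoDensity {W : Type*} (H : SimpleGraph W) : ℝ :=
  sSup {x : ℝ | ∃ F : H.Subgraph, 3 ≤ F.verts.ncard ∧
    x = ((F.edgeSet.ncard : ℝ) - 1) / ((F.verts.ncard : ℝ) - 2)}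

/-- The chromatic number of a graph on `Fin n`, as a natural number. -/
noncomputable def chi {n : ℕ} (G : SimpleGraph (Fin n)) : ℕ := G.chromaticNumber.toNat

/-- Graphs on `Fin n` have finite chromatic number, so `chi` is the chromatic number. -/
theorem coe_chi {n : ℕ} (G : SimpleGraph (Fin n)) : (G.chi : ℕ∞) = G.chromaticNumber :=
  ENat.natCast_toNat (chromaticNumber_ne_top_iff_exists.2 ⟨_, G.colorable_of_fintype⟩)

open scoped Classical in
/-- The minimum degree `δ(G)` of a graph on `Fin n`. -/
noncomputable def minDeg {n : ℕ} (G : SimpleGraph (Fin n)) : ℕ := G.minDegree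

/-- The binomial random graph `G(n, p(n))` has the property `P n` with high probability, i.e. with
probability tending to `1` as `n → ∞`. -/
def Whp (p : ℕ → unitInterval) (P : ∀ n : ℕ, SimpleGraph (Fin n) → Prop) : Prop :=
  Tendsto (fun n : ℕ => binomialRandom (Fin n) (p n) {Γ | P n Γ}) atTop (𝓝 1)

/-- The chromatic threshold `δ_χ(H, p)` of `H` with respect to `p = p(n)`. -/
noncomputable def chromaticThreshold {W : Type*} (H : SimpleGraph W) (p : ℕ → unitInterval) : ℝ :=
  sInf {d : ℝ | 0 < d ∧ ∃ C : ℝ, 0 < C ∧ Whp p fun n Γ =>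
    ∀ G : SimpleGraph (Fin n), G ≤ Γ → H.Free G → d * (p n : ℝ) * n ≤ (G.minDeg : ℝ) →
      (G.chi : ℝ) ≤ C}

end SimpleGraph

/-! Let F ⊆ H attain `twoDensity`, with v vertices and m edges. A vertex of G(n,p) lies in O(n^{v-1}
p^m) = O(pn · n^{v-2} p^{m-1}) copies of F in expectation, and p = o(n^{-1/m₂}) makes this o(pn).
Deleting all edges of a maximum family of edge-disjoint copies of F leaves an F-free, hence H-free,
graph (`exists_free_subgraph_lostNeighbors_le`). A vertex loses at most m edges per copy of the
family at it. The probability of k edge-disjoint copies at a vertex is at most μ^k / k!, with μ the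
bound on the expectation; for k ≈ β pn this is at most e^{-k}, and pn ≫ log n pays for a union bound
over the vertices (`whp_not_exists_disjoint_copies`).

So every vertex loses at most c·pn edges, with c as small as desired, and the minimum degree stays
near pn. Every set I of at least an vertices spans more than (a/8)pn|I| edges of G(n,p), which
exceeds what it can lose if c ≤ a/8. Hence no colour class has an vertices, and χ ≥ 1/a
(`one_le_mul_chi`).

The threshold is at least 1 by taking γ small, and at most 1 because for d > 1 whp no subgraph has
minimum degree dpn. -/

namespace SimpleGraph

/-! ### Edge independence, Chernoff bounds and disjoint families in G(n,p) -/

section Probability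

open MeasureTheory unitInterval

variable {V : Type*} [Fintype V]

open scoped Classical in
/-- The non-loop pairs of `V`. -/
noncomputable def pairs (V : Type*) [Fintype V] : Finset (Sym2 V) := Finset.univ.filter (¬ ·.IsDiag)

/-- As there are finitely many graphs on `V`, this makes every event measurable. -/
instance : MeasurableSingletonClass (SimpleGraph V) where
  measurableSet_singleton G := by
    have h : ({G} : Set (SimpleGraph V)) = edgeSet ⁻¹' {G.edgeSet} := by
      ext; simp
    rw [h]
    exact measurableEmbedding_edgeSet.measurable (MeasurableSet.singleton _)

lemma mem_pairs {e : Sym2 V} : e ∈ pairs V ↔ ¬ e.IsDiag := by simp [pairs]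

open scoped Classical in
lemma binomialRandom_real_singleton (p : I) (G : SimpleGraph V) :
    (binomialRandom V p).real {G} =
      (p : ℝ) ^ G.edgeFinset.card * (1 - p : ℝ) ^ (pairs V \ G.edgeFinset).card := by
  have hsub : G.edgeFinset ⊆ pairs V := fun e he ↦
    mem_pairs.2 (G.not_isDiag_of_mem_edgeSet (mem_edgeFinset.1 he))
  have hcard : (pairs V).card = (Nat.card V).choose 2 := by
    rw [Nat.card_eq_fintype_card, ← Sym2.card_subtype_not_diag, Fintype.card_subtype, pairs]
  rw [Finset.card_sdiff_of_subset hsub, hcard, measureReal_def, binomialRandom_singleton,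
    ← coe_edgeFinset, Set.ncard_coe_finset]
  simp

open scoped Classical in
/-- Independence of the edges: the expectation of a product of two-valued weights over a set of
pairs factorises. -/
theorem integral_prod_binomialRandom (p : I) {S : Finset (Sym2 V)} (hS : S ⊆ pairs V) (a b : ℝ) :
    ∫ Γ, ∏ e ∈ S, (if e ∈ Γ.edgeSet then a else b) ∂(binomialRandom V p) =
      (p * a + (1 - p) * b) ^ S.card := by
  -- Pairs outside `S` contribute the factor p + (1 - p) = 1. Expanding the product over all pairs
  -- gives one summand per edge set, that is, per graph.
  have h1 : ∏ e ∈ pairs V, ((p : ℝ) * (if e ∈ S then a else 1) +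
      (1 - p) * (if e ∈ S then b else 1)) = (p * a + (1 - p) * b) ^ S.card := by
    rw [← Finset.prod_sdiff hS, Finset.prod_congr rfl (g := fun _ ↦ (1 : ℝ)),
      Finset.prod_congr (s₁ := S) rfl (g := fun _ ↦ p * a + (1 - p) * b)]
    · simp
    · intro e he; simp [he]
    · intro e he; simp [(Finset.mem_sdiff.1 he).2]
  rw [integral_fintype .of_finite, ← h1, Finset.prod_add]
  refine Finset.sum_bij (fun Γ _ ↦ Γ.edgeFinset) ?_ ?_ ?_ ?_
  · intro Γ _
    exact Finset.mem_powerset.2 fun e he ↦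
      mem_pairs.2 (Γ.not_isDiag_of_mem_edgeSet (mem_edgeFinset.1 he))
  · intro Γ _ Γ' _ h
    exact edgeFinset_inj.1 h
  · intro T hT
    refine ⟨fromEdgeSet T, Finset.mem_univ _, ?_⟩
    ext e
    simp only [mem_edgeFinset, edgeSet_fromEdgeSet, Set.mem_sdiff, Finset.mem_coe]
    exact ⟨fun h ↦ h.1, fun h ↦ ⟨h, mem_pairs.1 (Finset.mem_powerset.1 hT h)⟩⟩
  · intro Γ _
    have hsub : Γ.edgeFinset ⊆ pairs V := fun e he ↦
      mem_pairs.2 (Γ.not_isDiag_of_mem_edgeSet (mem_edgeFinset.1 he))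
    have h2 : ∏ e ∈ S, (if e ∈ Γ.edgeSet then a else b) =
        (∏ e ∈ Γ.edgeFinset, if e ∈ S then a else 1) *
          ∏ e ∈ pairs V \ Γ.edgeFinset, if e ∈ S then b else 1 := by
      rw [← Finset.prod_filter, ← Finset.prod_filter, Finset.prod_ite]
      congr 1
      · refine Finset.prod_congr ?_ fun _ _ ↦ rfl
        ext e; simp [and_comm]
      · refine Finset.prod_congr ?_ fun _ _ ↦ rfl
        ext e
        simp only [Finset.mem_filter, Finset.mem_sdiff, mem_edgeFinset]
        exact ⟨fun h ↦ ⟨⟨hS h.1, h.2⟩, h.1⟩, fun h ↦ ⟨h.2, h.1.2⟩⟩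
    rw [binomialRandom_real_singleton, Finset.prod_mul_distrib, Finset.prod_mul_distrib, h2]
    simp only [Finset.prod_const, smul_eq_mul]
    ring

open scoped Classical in
/-- The number of edges of `Γ` in the set of pairs `S`. -/
noncomputable def edgeCount (S : Finset (Sym2 V)) (Γ : SimpleGraph V) : ℕ :=
  (S.filter (· ∈ Γ.edgeSet)).card

lemma integral_exp_edgeCount (p : I) {S : Finset (Sym2 V)} (hS : S ⊆ pairs V) (t : ℝ) :
    ∫ Γ, Real.exp (t * edgeCount S Γ) ∂(binomialRandom V p) =
      (p * Real.exp t + (1 - p)) ^ S.card := by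
  classical
  have := integral_prod_binomialRandom p hS (Real.exp t) 1
  rw [mul_one] at this
  rw [← this]
  refine integral_congr_ae (.of_forall fun Γ ↦ ?_)
  simp only [edgeCount, Finset.prod_ite, Finset.prod_const, one_pow, mul_one]
  rw [mul_comm, Real.exp_nat_mul]

lemma binomialRandom_real_subset (p : I) {S : Finset (Sym2 V)} (hS : S ⊆ pairs V) :
    (binomialRandom V p).real {Γ | (S : Set (Sym2 V)) ⊆ Γ.edgeSet} = (p : ℝ) ^ S.card := by
  classical
  have := integral_prod_binomialRandom p hS 1 0
  rw [mul_one, mul_zero, add_zero] at this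
  rw [← this, ← integral_indicator_one (Set.toFinite _).measurableSet]
  refine integral_congr_ae (.of_forall fun Γ ↦ ?_)
  by_cases h : (S : Set (Sym2 V)) ⊆ Γ.edgeSet
  · simp only [Set.indicator, Set.mem_ofPred_eq, h, if_true, Pi.one_apply]
    exact (Finset.prod_eq_one fun e he ↦ if_pos (h he)).symm
  · simp only [Set.indicator, Set.mem_ofPred_eq, h, if_false]
    obtain ⟨e, he, he'⟩ := Set.not_subset.1 h
    exact (Finset.prod_eq_zero he (if_neg he')).symm

/-- Exponential Markov inequality for the number of edges in `S`. -/
lemma binomialRandom_real_exp_le (p : I) {S : Finset (Sym2 V)} (hS : S ⊆ pairs V) (t c : ℝ) :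
    (binomialRandom V p).real {Γ | c ≤ t * edgeCount S Γ} ≤
      Real.exp (S.card * p * (Real.exp t - 1) - c) := by
  have h := mul_meas_ge_le_integral_of_nonneg (μ := binomialRandom V p)
    (f := fun Γ ↦ Real.exp (t * edgeCount S Γ)) (.of_forall fun Γ ↦ (Real.exp_pos _).le)
    .of_finite (Real.exp c)
  simp only [Real.exp_le_exp, integral_exp_edgeCount p hS] at h
  have h2 : (p * Real.exp t + (1 - p)) ^ S.card ≤ Real.exp (S.card * p * (Real.exp t - 1)) := by
    rw [mul_assoc, Real.exp_nat_mul]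
    have : 0 ≤ (p : ℝ) * Real.exp t + (1 - p) :=
      add_nonneg (mul_nonneg p.2.1 (Real.exp_pos _).le) (sub_nonneg.2 p.2.2)
    refine pow_le_pow_left₀ this ?_ _
    have := Real.add_one_le_exp ((p : ℝ) * (Real.exp t - 1))
    linarith
  rw [Real.exp_sub, le_div_iff₀ (Real.exp_pos _), mul_comm]
  exact h.trans h2

/-- Chernoff bound for the lower tail. -/
theorem binomialRandom_real_lower_tail (p : I) {S : Finset (Sym2 V)} (hS : S ⊆ pairs V) {ε : ℝ}
    (hε : 0 ≤ ε) :
    (binomialRandom V p).real {Γ | (edgeCount S Γ : ℝ) ≤ (1 - ε) * (S.card * p)} ≤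
      Real.exp (-(ε ^ 2 / 2 * (S.card * p))) := by
  have h := binomialRandom_real_exp_le p hS (-ε) (-ε * ((1 - ε) * (S.card * p)))
  refine (measureReal_mono ?_).trans (h.trans (Real.exp_le_exp.2 ?_))
  · intro Γ hΓ
    simp only [Set.mem_ofPred_eq] at hΓ ⊢
    nlinarith
  -- This holds since (1 - ε + ε²/2)(1 + ε + ε²/2) = 1 + ε⁴/4 and the second factor is at most e^ε.
  · have h1 : Real.exp (-ε) ≤ 1 - ε + ε ^ 2 / 2 := by
      have h3 := Real.quadratic_le_exp_of_nonneg hε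
      have h4 : Real.exp (-ε) * Real.exp ε = 1 := by rw [← Real.exp_add]; simp
      have h5 : 0 < 1 - ε + ε ^ 2 / 2 := by nlinarith [sq_nonneg (ε - 1)]
      have h6 : 1 ≤ (1 - ε + ε ^ 2 / 2) * (1 + ε + ε ^ 2 / 2) := by nlinarith [sq_nonneg (ε ^ 2)]
      refine le_of_mul_le_mul_right ?_ (Real.exp_pos ε)
      rw [h4]
      exact h6.trans (mul_le_mul_of_nonneg_left h3 h5.le)
    have h2 : 0 ≤ (S.card : ℝ) * p := mul_nonneg (Nat.cast_nonneg _) p.2.1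
    nlinarith

/-- Chernoff bound for the upper tail. -/
theorem binomialRandom_real_upper_tail (p : I) {S : Finset (Sym2 V)} (hS : S ⊆ pairs V) {t d : ℝ}
    (ht : 0 ≤ t) (ht1 : t ≤ 1) :
    (binomialRandom V p).real {Γ | d * (S.card * p) ≤ (edgeCount S Γ : ℝ)} ≤
      Real.exp (-(t * (d - 1 - t) * (S.card * p))) := by
  have h := binomialRandom_real_exp_le p hS t (t * (d * (S.card * p)))
  refine (measureReal_mono ?_).trans (h.trans (Real.exp_le_exp.2 ?_))
  · intro Γ hΓ
    exact mul_le_mul_of_nonneg_left hΓ ht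
  · have h1 : Real.exp t ≤ 1 + t + t ^ 2 := by
      have := Real.abs_exp_sub_one_sub_id_le (x := t) (by rw [abs_of_nonneg ht]; exact ht1)
      linarith [(abs_le.1 this).2]
    have h2 : 0 ≤ (S.card : ℝ) * p := mul_nonneg (Nat.cast_nonneg _) p.2.1
    nlinarith

/-- The probability that `Γ` contains `k` pairwise disjoint members of a family of `m`-element
edge sets. -/
theorem binomialRandom_real_disjoint_family (p : I) {C : Finset (Finset (Sym2 V))} {m k : ℕ}
    (hC : ∀ T ∈ C, T ⊆ pairs V ∧ T.card = m) :
    (binomialRandom V p).real {Γ | ∃ 𝒯 : Finset (Finset (Sym2 V)), 𝒯 ⊆ C ∧ 𝒯.card = k ∧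
        (𝒯 : Set (Finset (Sym2 V))).PairwiseDisjoint id ∧ ∀ T ∈ 𝒯, (T : Set (Sym2 V)) ⊆ Γ.edgeSet} ≤
      (C.card * (p : ℝ) ^ m) ^ k / k.factorial := by
  classical
  -- Union bound over unordered families, which gains the k!. Disjointness gives each union exactly
  -- km pairs, hence probability p^{mk}.
  set 𝓓 := (C.powersetCard k).filter fun 𝒯 : Finset (Finset (Sym2 V)) ↦
    (𝒯 : Set (Finset (Sym2 V))).PairwiseDisjoint id
  have hle : (binomialRandom V p).real {Γ | ∃ 𝒯 : Finset (Finset (Sym2 V)), 𝒯 ⊆ C ∧ 𝒯.card = k ∧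
        (𝒯 : Set (Finset (Sym2 V))).PairwiseDisjoint id ∧
          ∀ T ∈ 𝒯, (T : Set (Sym2 V)) ⊆ Γ.edgeSet} ≤
      ∑ 𝒯 ∈ 𝓓, (binomialRandom V p).real {Γ | ((𝒯.biUnion id : Finset _) : Set _) ⊆ Γ.edgeSet} := by
    refine (measureReal_mono ?_ (measure_ne_top _ _)).trans (measureReal_biUnion_finset_le 𝓓 _)
    rintro Γ ⟨𝒯, h𝒯, hk, hd, hΓ⟩
    simp only [Set.mem_iUnion]
    refine ⟨𝒯, Finset.mem_filter.2 ⟨Finset.mem_powersetCard.2 ⟨h𝒯, hk⟩, hd⟩, ?_⟩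
    simpa using hΓ
  have hterm : ∀ 𝒯 ∈ 𝓓, (binomialRandom V p).real
      {Γ | ((𝒯.biUnion id : Finset _) : Set _) ⊆ Γ.edgeSet} = ((p : ℝ) ^ m) ^ k := by
    intro 𝒯 h𝒯
    obtain ⟨h1, hd⟩ := Finset.mem_filter.1 h𝒯
    obtain ⟨hsub, hk⟩ := Finset.mem_powersetCard.1 h1
    rw [binomialRandom_real_subset p (S := 𝒯.biUnion id)
        (Finset.biUnion_subset.2 fun T hT ↦ (hC T (hsub hT)).1),
      Finset.card_biUnion hd, Finset.sum_congr (f := fun T ↦ (id T).card) (g := fun _ ↦ m) rfl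
        fun T hT ↦ (hC T (hsub hT)).2]
    simp [hk, pow_mul, mul_comm]
  rw [Finset.sum_congr rfl hterm, Finset.sum_const, nsmul_eq_mul] at hle
  refine hle.trans ?_
  have hcard : (𝓓.card : ℝ) ≤ (C.card : ℝ) ^ k / k.factorial := by
    refine le_trans ?_ (Nat.choose_le_pow_div k C.card)
    exact_mod_cast (Finset.card_filter_le _ _).trans (Finset.card_powersetCard _ _).le
  calc (𝓓.card : ℝ) * ((p : ℝ) ^ m) ^ k ≤ (C.card : ℝ) ^ k / k.factorial * ((p : ℝ) ^ m) ^ k :=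
        mul_le_mul_of_nonneg_right hcard (pow_nonneg (pow_nonneg p.2.1 _) _)
    _ = _ := by rw [mul_pow]; ring

end Probability

/-! ### Deleting copies, and independent sets in what remains -/

section Deterministic

variable {V α : Type*} [Fintype V] [Fintype α]

open scoped Classical in
/-- The set of pairs that `f` makes out of the edges of `A`. -/
noncomputable def copyEdges (A : SimpleGraph α) (f : α → V) : Finset (Sym2 V) :=
  A.edgeFinset.image (Sym2.map f)

open scoped Classical in
/-- The edge sets of the copies of `A` in the complete graph on `V`. -/
noncomputable def copySets (A : SimpleGraph α) (V : Type*) [Fintype V] :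
    Finset (Finset (Sym2 V)) :=
  (Finset.univ.filter fun f : α → V ↦ Function.Injective f).image A.copyEdges

open scoped Classical in
/-- The edge sets of the copies of `A` in the complete graph on `V` with an edge at `x`. -/
noncomputable def copySetsAt (A : SimpleGraph α) (x : V) : Finset (Finset (Sym2 V)) :=
  (A.copySets V).filter fun T ↦ ∃ e ∈ T, x ∈ e

lemma copySetsAt_subset_copySets (A : SimpleGraph α) (x : V) : A.copySetsAt x ⊆ A.copySets V := by
  classical
  exact Finset.filter_subset _ _

lemma subset_pairs_and_card_of_mem_copySets {A : SimpleGraph α} {T : Finset (Sym2 V)}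
    (hT : T ∈ A.copySets V) : T ⊆ pairs V ∧ T.card = A.edgeSet.ncard := by
  classical
  simp only [copySets, Finset.mem_image, Finset.mem_filter, Finset.mem_univ, true_and] at hT
  obtain ⟨f, hf, rfl⟩ := hT
  constructor
  · intro e he
    simp only [copyEdges, Finset.mem_image, mem_edgeFinset] at he
    obtain ⟨e, he, rfl⟩ := he
    rw [mem_pairs, Sym2.isDiag_map hf]
    exact A.not_isDiag_of_mem_edgeSet he
  · rw [copyEdges, Finset.card_image_of_injective _ (Sym2.map.injective hf), ← coe_edgeFinset,
      Set.ncard_coe_finset]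

/-- Such a copy comes from a map sending some vertex `a` to `x`: there are v choices of `a`, and at
most |V| for each of the other v - 1 values. -/
lemma card_copySetsAt_le (A : SimpleGraph α) (x : V) :
    (A.copySetsAt x).card ≤ Fintype.card α * Fintype.card V ^ (Fintype.card α - 1) := by
  classical
  set Q : α → Finset (α → V) := fun a ↦
    Fintype.piFinset fun b ↦ if b = a then {x} else Finset.univ
  have hQ : ∀ a, (Q a).card = Fintype.card V ^ (Fintype.card α - 1) := by
    intro a
    simp only [Q, Fintype.card_piFinset, apply_ite Finset.card, Finset.card_singleton,
      Finset.card_univ, Finset.prod_ite, Finset.prod_const_one, one_mul, Finset.prod_const]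
    rw [Finset.filter_ne', Finset.card_erase_of_mem (Finset.mem_univ _), Finset.card_univ]
  have hsub : A.copySetsAt x ⊆ (Finset.univ.biUnion Q).image A.copyEdges := by
    intro T hT
    simp only [copySetsAt, copySets, Finset.mem_image, Finset.mem_filter, Finset.mem_univ,
      true_and] at hT
    obtain ⟨⟨f, hf, rfl⟩, e, he, hx⟩ := hT
    simp only [copyEdges, Finset.mem_image] at he
    obtain ⟨e, -, rfl⟩ := he
    obtain ⟨a, -, rfl⟩ := Sym2.mem_map.1 hx
    refine Finset.mem_image_of_mem _ (Finset.mem_biUnion.2 ⟨a, Finset.mem_univ _, ?_⟩)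
    refine Fintype.mem_piFinset.2 fun b ↦ ?_
    split_ifs with h <;> simp [h]
  calc (A.copySetsAt x).card ≤ (Finset.univ.biUnion Q).card :=
        (Finset.card_le_card hsub).trans Finset.card_image_le
    _ ≤ Finset.univ.card * Fintype.card V ^ (Fintype.card α - 1) :=
        Finset.card_biUnion_le_card_mul _ _ _ fun a _ ↦ (hQ a).le
    _ = _ := by rw [Finset.card_univ]

open scoped Classical in
/-- The neighbours of `x` in `Γ` that are not neighbours of `x` in `G`. -/
noncomputable def lostNeighbors (Γ G : SimpleGraph V) (x : V) : Finset V :=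
  Finset.univ.filter fun y ↦ Γ.Adj x y ∧ ¬ G.Adj x y

/-- Deleting the edges of a maximum family of edge-disjoint copies of `A` leaves an `A`-free graph;
the degree of a vertex drops little if the vertex lies in few edge-disjoint copies. -/
theorem exists_free_subgraph_lostNeighbors_le (A : SimpleGraph α) (hA : A.edgeSet.Nonempty)
    (Γ : SimpleGraph V) (k : ℕ)
    (hk : ∀ x, ¬ ∃ 𝒯 : Finset (Finset (Sym2 V)), 𝒯 ⊆ A.copySetsAt x ∧ 𝒯.card = k ∧
      (𝒯 : Set (Finset (Sym2 V))).PairwiseDisjoint id ∧ ∀ T ∈ 𝒯, (T : Set (Sym2 V)) ⊆ Γ.edgeSet) :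
    ∃ G ≤ Γ, A.Free G ∧ ∀ x, (lostNeighbors Γ G x).card ≤ k * A.edgeSet.ncard := by
  classical
  set 𝓓 : Finset (Finset (Finset (Sym2 V))) := (A.copySets V).powerset.filter fun 𝒯 ↦
    (𝒯 : Set (Finset (Sym2 V))).PairwiseDisjoint id ∧ ∀ T ∈ 𝒯, (T : Set (Sym2 V)) ⊆ Γ.edgeSet
  have hne : 𝓓.Nonempty := ⟨∅, by simp [𝓓]⟩
  obtain ⟨𝒯, h𝒯, hmax⟩ := 𝓓.exists_max_image Finset.card hne
  obtain ⟨hsub, hdis, hΓ⟩ := Finset.mem_filter.1 h𝒯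
  rw [Finset.mem_powerset] at hsub
  have hadj : ∀ x y, (Γ.deleteEdges ((𝒯.biUnion id : Finset _) : Set (Sym2 V))).Adj x y ↔
      Γ.Adj x y ∧ ∀ T ∈ 𝒯, s(x, y) ∉ T := by
    intro x y
    simp [deleteEdges_adj]
  refine ⟨Γ.deleteEdges ((𝒯.biUnion id : Finset _) : Set (Sym2 V)), deleteEdges_le _, ?_, ?_⟩
  · rintro ⟨f⟩
    have hcopy : ∀ e ∈ A.copyEdges f, e ∈ Γ.edgeSet ∧ ∀ T ∈ 𝒯, e ∉ T := by
      intro e he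
      simp only [copyEdges, Finset.mem_image, mem_edgeFinset] at he
      obtain ⟨e, he, rfl⟩ := he
      induction e with
      | _ a b => exact (hadj _ _).1 (f.toHom.map_adj he)
    have hmem : A.copyEdges f ∈ A.copySets V :=
      Finset.mem_image_of_mem _ (by simpa using f.injective)
    -- A surviving copy avoids all members of `𝒯`; as it has an edge it is not itself a member, so
    -- adding it contradicts maximality.
    have hnot : A.copyEdges f ∉ 𝒯 := by
      intro h
      obtain ⟨e, he⟩ := hA
      have : Sym2.map f e ∈ A.copyEdges f :=
        Finset.mem_image_of_mem _ (mem_edgeFinset.2 he)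
      exact (hcopy _ this).2 _ h this
    have hins : insert (A.copyEdges f) 𝒯 ∈ 𝓓 := by
      refine Finset.mem_filter.2 ⟨Finset.mem_powerset.2 (Finset.insert_subset hmem hsub), ?_, ?_⟩
      · rw [Finset.coe_insert]
        refine hdis.insert fun T hT _ ↦ ?_
        exact Finset.disjoint_left.2 fun e he he' ↦ (hcopy e he).2 T hT he'
      · intro T hT
        rcases Finset.mem_insert.1 hT with rfl | hT
        · exact fun e he ↦ (hcopy e he).1
        · exact hΓ T hT
    have := hmax _ hins
    rw [Finset.card_insert_of_notMem hnot] at this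
    omega
  · intro x
    set 𝒯x := 𝒯.filter fun T ↦ ∃ e ∈ T, x ∈ e
    have hlt : 𝒯x.card ≤ k := by
      by_contra! hlt
      obtain ⟨𝒮, h𝒮, hcard⟩ := Finset.exists_subset_card_eq hlt.le
      refine hk x ⟨𝒮, fun T hT ↦ ?_, hcard, ?_, fun T hT ↦ ?_⟩
      · have := Finset.mem_filter.1 (h𝒮 hT)
        exact Finset.mem_filter.2 ⟨hsub this.1, this.2⟩
      · exact hdis.subset fun T hT ↦ (Finset.mem_filter.1 (h𝒮 hT)).1
      · exact hΓ T (Finset.mem_filter.1 (h𝒮 hT)).1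
    calc (lostNeighbors Γ _ x).card ≤ (𝒯x.biUnion id).card := by
          refine Finset.card_le_card_of_injOn (fun y ↦ s(x, y)) ?_ ?_
          · intro y hy
            simp only [lostNeighbors, hadj, Finset.coe_filter, Finset.mem_univ, true_and,
              Set.mem_ofPred_eq] at hy
            obtain ⟨h1, h2⟩ := hy
            push Not at h2
            obtain ⟨T, hT, hmem⟩ := h2 h1
            exact Finset.mem_biUnion.2
              ⟨T, Finset.mem_filter.2 ⟨hT, _, hmem, Sym2.mem_mk_left x y⟩, hmem⟩
          · intro y _ z _ h
            exact Sym2.congr_right.1 h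
      _ ≤ 𝒯x.card * A.edgeSet.ncard := Finset.card_biUnion_le_card_mul _ _ _ fun T hT ↦
          (subset_pairs_and_card_of_mem_copySets (hsub (Finset.mem_filter.1 hT).1)).2.le
      _ ≤ _ := Nat.mul_le_mul_right _ hlt

open scoped Classical in
/-- The pairs inside `I`. -/
noncomputable def pairsIn (I : Finset V) : Finset (Sym2 V) := I.offDiag.image fun z ↦ s(z.1, z.2)

lemma pairsIn_subset_pairs (I : Finset V) : pairsIn I ⊆ pairs V := by
  classical
  intro e he
  simp only [pairsIn, Finset.mem_image, Finset.mem_offDiag] at he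
  obtain ⟨⟨x, y⟩, h, rfl⟩ := he
  simpa [mem_pairs] using h.2.2

lemma card_pairsIn {V : Type*} (I : Finset V) : (pairsIn I).card = I.card.choose 2 := by
  classical
  exact Sym2.card_image_offDiag I

open scoped Classical in
/-- The pairs at `x`. -/
noncomputable def pairsAt (x : V) : Finset (Sym2 V) := (Finset.univ.erase x).image fun y ↦ s(x, y)

lemma pairsAt_subset_pairs (x : V) : pairsAt x ⊆ pairs V := by
  classical
  intro e he
  simp only [pairsAt, Finset.mem_image, Finset.mem_erase] at he
  obtain ⟨y, h, rfl⟩ := he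
  simpa [mem_pairs] using h.1.symm

lemma card_pairsAt (x : V) : (pairsAt x).card = Fintype.card V - 1 := by
  classical
  rw [pairsAt, Finset.card_image_of_injective _ fun y z h ↦ Sym2.congr_right.1 h,
    Finset.card_erase_of_mem (Finset.mem_univ _), Finset.card_univ]

open scoped Classical in
lemma edgeCount_pairsAt (Γ : SimpleGraph V) (x : V) : edgeCount (pairsAt x) Γ = Γ.degree x := by
  rw [edgeCount, pairsAt, Finset.filter_image,
    Finset.card_image_of_injective _ fun y z h ↦ Sym2.congr_right.1 h,
    ← card_neighborFinset_eq_degree]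
  congr 1
  ext y
  simp only [Finset.mem_filter, Finset.mem_erase, Finset.mem_univ, and_true, mem_edgeSet,
    mem_neighborFinset, and_iff_right_iff_imp]
  exact fun h ↦ h.ne'

open scoped Classical in
lemma degree_le_degree_add_card_lostNeighbors (Γ G : SimpleGraph V) (x : V) :
    Γ.degree x ≤ G.degree x + (lostNeighbors Γ G x).card := by
  rw [← card_neighborFinset_eq_degree, ← card_neighborFinset_eq_degree]
  refine (Finset.card_le_card fun y hy ↦ ?_).trans (Finset.card_union_le _ _)
  rw [mem_neighborFinset] at hy
  by_cases h : G.Adj x y <;> simp [lostNeighbors, h, hy]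

/-- If large vertex sets span more edges of `Γ` than can get lost, then the subgraph `G` has no
large independent sets, and so its chromatic number is large. -/
theorem one_le_mul_chi {n : ℕ} (Γ G : SimpleGraph (Fin n)) (hn : 0 < n) {a L : ℝ}
    (hL : ∀ x, ((lostNeighbors Γ G x).card : ℝ) ≤ L)
    (hI : ∀ I : Finset (Fin n), a * n ≤ I.card → I.card * L < edgeCount (pairsIn I) Γ) :
    1 ≤ a * G.chi := by
  classical
  by_contra! hlt
  obtain ⟨c⟩ : G.Colorable G.chi :=
    chromaticNumber_le_iff_colorable.1 G.coe_chi.ge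
  have hpos : (Finset.univ : Finset (Fin G.chi)).Nonempty := ⟨c ⟨0, hn⟩, Finset.mem_univ _⟩
  -- Pigeonhole: if a·χ < 1, some colour class has at least an vertices.
  obtain ⟨y, -, hy⟩ := Finset.exists_le_card_fiber_of_nsmul_le_card_of_maps_to
    (s := (Finset.univ : Finset (Fin n))) (f := c) (b := a * n) (fun _ _ ↦ Finset.mem_univ _) hpos
    (by
      simp only [Finset.card_univ, Fintype.card_fin, nsmul_eq_mul]
      have : (0 : ℝ) ≤ n := Nat.cast_nonneg n
      nlinarith)
  set I : Finset (Fin n) := Finset.univ.filter fun x ↦ c x = y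
  have hmem : ∀ {x}, x ∈ I ↔ c x = y := by simp [I]
  refine (hI I hy).not_ge ?_
  -- The class is independent in `G`, so every edge of `Γ` inside it was lost at one of its
  -- vertices.
  have hsub : (pairsIn I).filter (· ∈ Γ.edgeSet) ⊆
      I.biUnion fun x ↦ (lostNeighbors Γ G x).image fun z ↦ s(x, z) := by
    intro e he
    simp only [pairsIn, Finset.mem_filter, Finset.mem_image, Finset.mem_offDiag] at he
    obtain ⟨⟨⟨x, z⟩, ⟨hx, hz, -⟩, rfl⟩, hΓ⟩ := he
    refine Finset.mem_biUnion.2 ⟨x, hx, Finset.mem_image_of_mem _ ?_⟩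
    simp only [lostNeighbors, Finset.mem_filter, Finset.mem_univ, true_and]
    exact ⟨hΓ, fun h ↦ c.valid h ((hmem.1 hx).trans (hmem.1 hz).symm)⟩
  calc (edgeCount (pairsIn I) Γ : ℝ)
      ≤ ∑ x ∈ I, ((lostNeighbors Γ G x).card : ℝ) := by
        rw [edgeCount]
        refine (Nat.cast_le.2 ((Finset.card_le_card hsub).trans Finset.card_biUnion_le)).trans ?_
        push_cast
        exact Finset.sum_le_sum fun x _ ↦ Nat.cast_le.2 Finset.card_image_le
    _ ≤ I.card * L := by
        simpa using Finset.sum_le_card_nsmul I _ L fun x _ ↦ hL x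

end Deterministic

/-! ### Calculus of events holding with high probability -/

section Whp

open MeasureTheory

variable {p : ℕ → unitInterval} {P Q : ∀ n : ℕ, SimpleGraph (Fin n) → Prop}

lemma whp_iff : Whp p P ↔
    Tendsto (fun n ↦ (binomialRandom (Fin n) (p n)).real {Γ | ¬ P n Γ}) atTop (𝓝 0) := by
  have h : ∀ n, (binomialRandom (Fin n) (p n)).real {Γ | ¬ P n Γ} =
      1 - (binomialRandom (Fin n) (p n)).real {Γ | P n Γ} := fun n ↦
    probReal_compl_eq_one_sub (Set.toFinite _).measurableSet
  simp only [h, Whp]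
  rw [← ENNReal.tendsto_toReal_iff (fun _ ↦ measure_ne_top _ _) ENNReal.one_ne_top,
    ENNReal.toReal_one]
  constructor
  · intro hP
    simpa [measureReal_def] using hP.const_sub 1
  · intro hP
    simpa [measureReal_def] using hP.const_sub 1

lemma Whp.of_real_le {b : ℕ → ℝ} (hb : Tendsto b atTop (𝓝 0))
    (h : ∀ᶠ n in atTop, (binomialRandom (Fin n) (p n)).real {Γ | ¬ P n Γ} ≤ b n) : Whp p P :=
  whp_iff.2 (squeeze_zero' (.of_forall fun _ ↦ measureReal_nonneg) h hb)

lemma Whp.and (hP : Whp p P) (hQ : Whp p Q) : Whp p fun n Γ ↦ P n Γ ∧ Q n Γ := by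
  have h := (whp_iff.1 hP).add (whp_iff.1 hQ)
  rw [add_zero] at h
  refine .of_real_le h (.of_forall fun n ↦ ?_)
  refine (measureReal_mono fun Γ hΓ ↦ ?_).trans (measureReal_union_le _ _)
  exact not_and_or.1 hΓ

lemma Whp.mono (hP : Whp p P) (h : ∀ᶠ n in atTop, ∀ Γ, P n Γ → Q n Γ) : Whp p Q := by
  refine .of_real_le (whp_iff.1 hP) ?_
  filter_upwards [h] with n hn
  exact measureReal_mono fun Γ hΓ hP ↦ hΓ (hn Γ hP)

lemma not_whp_false : ¬ Whp p fun _ _ ↦ False := by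
  intro h
  simp only [Whp, Set.ofPred_false, measure_empty] at h
  exact zero_ne_one (tendsto_nhds_unique tendsto_const_nhds h)

lemma binomialRandom_real_exists_le {V ι : Type*} [Fintype V] [Fintype ι] (p : unitInterval)
    (B : ι → SimpleGraph V → Prop) {b : ℝ} (h : ∀ i, (binomialRandom V p).real {Γ | B i Γ} ≤ b) :
    (binomialRandom V p).real {Γ | ∃ i, B i Γ} ≤ Fintype.card ι * b := by
  have : {Γ | ∃ i, B i Γ} = ⋃ i, {Γ | B i Γ} := by ext; simp
  rw [this]
  refine (measureReal_iUnion_fintype_le _).trans ?_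
  refine (Finset.sum_le_card_nsmul _ _ b fun i _ ↦ h i).trans ?_
  simp

end Whp

/-! ### Typical properties of G(n,p) when pn ≫ log n -/

section Asymptotics

open MeasureTheory

variable {p : ℕ → unitInterval}

lemma eventually_mul_log_le
    (hp : (fun n : ℕ => Real.log n / n) =o[atTop] (fun n : ℕ => (p n : ℝ))) {K : ℝ} (hK : 0 < K) :
    ∀ᶠ n : ℕ in atTop, K * Real.log n ≤ p n * n := by
  filter_upwards [hp.bound (inv_pos.2 hK), eventually_gt_atTop 0] with n hn hn0
  have hn' : (0 : ℝ) < n := Nat.cast_pos.2 hn0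
  rw [Real.norm_of_nonneg (p n).2.1, Real.norm_of_nonneg
    (div_nonneg (Real.log_natCast_nonneg n) hn'.le), div_le_iff₀ hn'] at hn
  calc K * Real.log n ≤ K * (K⁻¹ * p n * n) := mul_le_mul_of_nonneg_left hn hK.le
    _ = p n * n := by field_simp

lemma tendsto_mul_natCast_atTop
    (hp : (fun n : ℕ => Real.log n / n) =o[atTop] (fun n : ℕ => (p n : ℝ))) :
    Tendsto (fun n : ℕ ↦ (p n : ℝ) * n) atTop atTop := by
  refine tendsto_atTop_mono' _ (eventually_mul_log_le hp one_pos) ?_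
  simpa [Function.comp_def] using Real.tendsto_log_atTop.comp tendsto_natCast_atTop_atTop

lemma natCast_mul_exp_neg_le {n : ℕ} (hn : 0 < n) {y : ℝ} (hy : 2 * Real.log n ≤ y) :
    n * Real.exp (-y) ≤ (n : ℝ)⁻¹ := by
  have hn' : (0 : ℝ) < n := Nat.cast_pos.2 hn
  calc n * Real.exp (-y) ≤ n * Real.exp (-(Real.log n + Real.log n)) :=
        mul_le_mul_of_nonneg_left (Real.exp_le_exp.2 (by linarith)) hn'.le
    _ = (n : ℝ)⁻¹ := by
        rw [Real.exp_neg, Real.exp_add, Real.exp_log hn']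
        field_simp

open scoped Classical in
/-- All degrees are at least about `pn`. -/
theorem whp_le_degree
    (hp : (fun n : ℕ => Real.log n / n) =o[atTop] (fun n : ℕ => (p n : ℝ))) {ε : ℝ} (hε : 0 < ε) :
    Whp p fun n Γ ↦ ∀ x, (1 - ε) * (p n : ℝ) * n ≤ (Γ.degree x : ℝ) := by
  refine .of_real_le tendsto_inv_atTop_nhds_zero_nat ?_
  have hlarge := tendsto_natCast_atTop_atTop (R := ℝ) |>.eventually_ge_atTop (2 / ε)
  -- The tail bound is used with ε/2, the slack absorbing the mean (n-1)p in place of np. Its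
  -- exponent is at least ε²pn/16, so K = 32/ε² yields 2 log n.
  filter_upwards [eventually_mul_log_le hp (K := 32 / ε ^ 2) (by positivity),
    eventually_ge_atTop 2, hlarge] with n hn hn2 hnε
  have hn2' : (2 : ℝ) ≤ n := by exact_mod_cast hn2
  have hnε' : 2 ≤ n * ε := (div_le_iff₀ hε).1 hnε
  have hp0 := (p n).2.1
  have hcard : ∀ x : Fin n, ((pairsAt x).card : ℝ) = n - 1 := fun x ↦ by
    rw [card_pairsAt, Fintype.card_fin, Nat.cast_sub (by omega), Nat.cast_one]
  have hx : ∀ x : Fin n, (binomialRandom (Fin n) (p n)).real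
      {Γ | ¬ (1 - ε) * (p n : ℝ) * n ≤ (Γ.degree x : ℝ)} ≤
        Real.exp (-((ε / 2) ^ 2 / 2 * ((n - 1) * p n))) := by
    intro x
    have h := binomialRandom_real_lower_tail (p n) (pairsAt_subset_pairs x) (half_pos hε).le
    rw [hcard] at h
    refine (measureReal_mono fun Γ hΓ ↦ ?_).trans h
    simp only [Set.mem_ofPred_eq, not_le, edgeCount_pairsAt] at hΓ ⊢
    refine hΓ.le.trans ?_
    have : 0 ≤ (p n : ℝ) * ((1 - ε / 2) * (n - 1) - (1 - ε) * n) :=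
      mul_nonneg hp0 (by nlinarith)
    nlinarith
  have hU := binomialRandom_real_exists_le (p n)
    (fun (x : Fin n) Γ ↦ ¬ (1 - ε) * (p n : ℝ) * n ≤ (Γ.degree x : ℝ)) hx
  simp only [← not_forall, Fintype.card_fin] at hU
  refine hU.trans (natCast_mul_exp_neg_le (by omega) ?_)
  rw [div_mul_eq_mul_div, div_le_iff₀ (by positivity)] at hn
  have h2 : (p n : ℝ) * n ≤ 2 * ((n - 1) * p n) := by nlinarith
  have h3 : (p n : ℝ) * n * ε ^ 2 ≤ 2 * ((n - 1) * p n) * ε ^ 2 :=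
    mul_le_mul_of_nonneg_right h2 (by positivity)
  nlinarith

/-- All large vertex sets span about as many edges as expected. -/
theorem whp_lt_edgeCount_pairsIn
    (hp : (fun n : ℕ => Real.log n / n) =o[atTop] (fun n : ℕ => (p n : ℝ))) {a : ℝ} (ha : 0 < a) :
    Whp p fun n Γ ↦ ∀ I : Finset (Fin n), a * n ≤ I.card →
      (p n : ℝ) * n * (a / 8) * I.card < edgeCount (pairsIn I) Γ := by
  have hlim : Tendsto (fun n : ℕ ↦ Real.exp (-(n : ℝ))) atTop (𝓝 0) :=
    Real.tendsto_exp_neg_atTop_nhds_zero.comp tendsto_natCast_atTop_atTop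
  refine .of_real_le hlim ?_
  have hlarge := tendsto_natCast_atTop_atTop (R := ℝ) |>.eventually_ge_atTop (2 / a)
  -- na ≥ 2 gives |I| - 1 ≥ an/2. The bound pn ≥ 64/a² makes each failure probability at most
  -- e^{-2n}, against at most e^n sets.
  filter_upwards [hlarge, tendsto_mul_natCast_atTop hp |>.eventually_ge_atTop (64 / a ^ 2)]
    with n hna hpn
  have hna' : 2 ≤ n * a := (div_le_iff₀ ha).1 hna
  have hp0 := (p n).2.1
  have hn0 : (0 : ℝ) ≤ n := Nat.cast_nonneg n
  have hI : ∀ I : Finset (Fin n), (binomialRandom (Fin n) (p n)).real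
      {Γ | ¬ (a * n ≤ I.card → (p n : ℝ) * n * (a / 8) * I.card < edgeCount (pairsIn I) Γ)} ≤
        Real.exp (-(a ^ 2 / 32 * (p n * n) * n)) := by
    intro I
    by_cases hcard : a * n ≤ I.card
    · have hch : ((pairsIn I).card : ℝ) = I.card * (I.card - 1) / 2 := by
        rw [card_pairsIn, Nat.cast_choose_two]
      have hlow : a * n / 2 ≤ (I.card : ℝ) - 1 := by linarith
      have hprod : (I.card : ℝ) * (a * n / 2) ≤ I.card * (I.card - 1) :=
        mul_le_mul_of_nonneg_left hlow (Nat.cast_nonneg _)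
      have hprod' : a * n * (a * n / 2) ≤ (I.card : ℝ) * (a * n / 2) :=
        mul_le_mul_of_nonneg_right hcard (by positivity)
      have h := binomialRandom_real_lower_tail (p n) (pairsIn_subset_pairs I)
        (ε := 1 / 2) (by norm_num)
      refine (measureReal_mono fun Γ hΓ ↦ ?_).trans (h.trans (Real.exp_le_exp.2 ?_))
      · simp only [Set.mem_ofPred_eq, hcard, true_imp_iff, not_lt] at hΓ ⊢
        refine hΓ.trans ?_
        rw [hch]
        have := mul_le_mul_of_nonneg_left hprod hp0
        nlinarith
      · rw [hch]
        have := mul_le_mul_of_nonneg_left (hprod'.trans hprod) hp0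
        nlinarith
    · simp only [hcard, false_imp_iff, not_true, Set.ofPred_false, measureReal_empty]
      exact (Real.exp_pos _).le
  have hU := binomialRandom_real_exists_le (p n) (fun (I : Finset (Fin n)) Γ ↦
    ¬ (a * n ≤ I.card → (p n : ℝ) * n * (a / 8) * I.card < edgeCount (pairsIn I) Γ)) hI
  simp only [← not_forall, Fintype.card_finset, Fintype.card_fin] at hU
  refine hU.trans ?_
  have h2 : ((2 ^ n : ℕ) : ℝ) ≤ Real.exp n := by
    have := Real.add_one_le_exp (1 : ℝ)
    have h3 := pow_le_pow_left₀ (by norm_num) (show (2 : ℝ) ≤ Real.exp 1 by linarith) n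
    rw [← Real.exp_nat_mul, mul_one] at h3
    exact_mod_cast h3
  refine (mul_le_mul_of_nonneg_right h2 (Real.exp_pos _).le).trans ?_
  rw [← Real.exp_add, Real.exp_le_exp]
  have h4 : 2 ≤ a ^ 2 / 32 * (p n * n) := by
    rw [div_le_iff₀ (by positivity)] at hpn
    linarith
  nlinarith

/-- No vertex lies in linearly many (in `pn`) edge-disjoint copies of a graph `A` that has fewer
copies than edges in expectation. -/
theorem whp_not_exists_disjoint_copies
    (hp : (fun n : ℕ => Real.log n / n) =o[atTop] (fun n : ℕ => (p n : ℝ)))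
    {α : Type*} [Fintype α] (A : SimpleGraph α) (hα : 2 ≤ Fintype.card α)
    (hA : 1 ≤ A.edgeSet.ncard)
    (hη : Tendsto (fun n : ℕ ↦ (n : ℝ) ^ (Fintype.card α - 2) * (p n : ℝ) ^ (A.edgeSet.ncard - 1))
      atTop (𝓝 0)) {β : ℝ} (hβ : 0 < β) :
    Whp p fun n Γ ↦ ∀ x, ¬ ∃ 𝒯 : Finset (Finset (Sym2 (Fin n))), 𝒯 ⊆ A.copySetsAt x ∧
      𝒯.card = ⌈β * (p n * n)⌉₊ ∧ (𝒯 : Set (Finset (Sym2 (Fin n)))).PairwiseDisjoint id ∧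
        ∀ T ∈ 𝒯, (T : Set (Sym2 (Fin n))) ⊆ Γ.edgeSet := by
  refine .of_real_le tendsto_inv_atTop_nhds_zero_nat ?_
  have hη' := hη.const_mul (Fintype.card α : ℝ)
  rw [mul_zero] at hη'
  filter_upwards [eventually_mul_log_le hp (K := 2 / β) (by positivity), eventually_gt_atTop 0,
    hη'.eventually_le_const (show 0 < β * Real.exp (-2) by positivity)] with n hn hn0 hsmall
  set v := Fintype.card α
  set m := A.edgeSet.ncard
  set k := ⌈β * (p n * n)⌉₊ with hk
  have hp0 := (p n).2.1
  have hk' : β * (p n * n) ≤ k := Nat.le_ceil _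
  have hx : ∀ x : Fin n, (binomialRandom (Fin n) (p n)).real
      {Γ | ∃ 𝒯 : Finset (Finset (Sym2 (Fin n))), 𝒯 ⊆ A.copySetsAt x ∧
      𝒯.card = k ∧ (𝒯 : Set (Finset (Sym2 (Fin n)))).PairwiseDisjoint id ∧
        ∀ T ∈ 𝒯, (T : Set (Sym2 (Fin n))) ⊆ Γ.edgeSet} ≤ Real.exp (-k) := by
    intro x
    have h := binomialRandom_real_disjoint_family (p n) (C := A.copySetsAt x) (m := m) (k := k)
      fun T hT ↦ subset_pairs_and_card_of_mem_copySets (copySetsAt_subset_copySets A x hT)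
    refine h.trans ?_
    -- With this bound on the expected number of copies, k^k / k! ≤ e^k turns the estimate μ^k / k!
    -- into e^{-k}.
    have hC : ((A.copySetsAt x).card : ℝ) * (p n : ℝ) ^ m ≤ k * Real.exp (-2) := by
      have h1 : ((A.copySetsAt x).card : ℝ) ≤ v * (n : ℝ) ^ (v - 1) := by
        have := card_copySetsAt_le A x
        rw [Fintype.card_fin] at this
        exact_mod_cast this
      calc ((A.copySetsAt x).card : ℝ) * (p n : ℝ) ^ m
          ≤ v * (n : ℝ) ^ (v - 1) * (p n : ℝ) ^ m :=
            mul_le_mul_of_nonneg_right h1 (pow_nonneg hp0 _)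
        _ = p n * n * (v * ((n : ℝ) ^ (v - 2) * (p n : ℝ) ^ (m - 1))) := by
            obtain ⟨v', hv'⟩ : ∃ v', v = v' + 2 := ⟨v - 2, by omega⟩
            obtain ⟨m', hm'⟩ : ∃ m', m = m' + 1 := ⟨m - 1, by omega⟩
            rw [hv', hm']
            simp only [Nat.add_sub_cancel, show v' + 2 - 1 = v' + 1 from rfl, pow_succ]
            ring
        _ ≤ p n * n * (β * Real.exp (-2)) :=
            mul_le_mul_of_nonneg_left hsmall (mul_nonneg hp0 (Nat.cast_nonneg _))
        _ = β * (p n * n) * Real.exp (-2) := by ring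
        _ ≤ k * Real.exp (-2) := mul_le_mul_of_nonneg_right hk' (Real.exp_pos _).le
    have hfac : (k : ℝ) ^ k / k.factorial ≤ Real.exp k := by
      refine le_trans ?_ (Real.sum_le_exp_of_nonneg (Nat.cast_nonneg k) (k + 1))
      exact Finset.single_le_sum (f := fun i ↦ (k : ℝ) ^ i / i.factorial)
        (fun i _ ↦ by positivity) (Finset.mem_range.2 k.lt_succ_self)
    calc (((A.copySetsAt x).card : ℝ) * (p n : ℝ) ^ m) ^ k / k.factorial
        ≤ (k * Real.exp (-2)) ^ k / k.factorial := by
          gcongr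
      _ = (k : ℝ) ^ k / k.factorial * Real.exp (-2) ^ k := by rw [mul_pow]; ring
      _ ≤ Real.exp k * Real.exp (-2) ^ k := by gcongr
      _ = Real.exp (-k) := by
          rw [← Real.exp_nat_mul, ← Real.exp_add]
          ring_nf
  have hU := binomialRandom_real_exists_le (p n) _ hx
  simp only [Fintype.card_fin] at hU
  simp only [not_forall, not_not]
  refine hU.trans (natCast_mul_exp_neg_le hn0 ?_)
  refine le_trans ?_ hk'
  rw [div_mul_eq_mul_div, div_le_iff₀ hβ] at hn
  linarith

/-- No subgraph of `G(n, p)` has minimum degree much larger than `pn`. -/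
theorem whp_minDeg_lt
    (hp : (fun n : ℕ => Real.log n / n) =o[atTop] (fun n : ℕ => (p n : ℝ))) {d : ℝ} (hd : 1 < d) :
    Whp p fun n Γ ↦ ∀ G ≤ Γ, (G.minDeg : ℝ) < d * (p n : ℝ) * n := by
  classical
  -- This choice satisfies t ≤ 1 and keeps d - 1 - t positive, as the upper tail bound requires.
  set t : ℝ := min 1 ((d - 1) / 2)
  have ht : 0 < t := lt_min one_pos (by linarith)
  have htd : t ≤ (d - 1) / 2 := min_le_right _ _
  have hc : 0 < t * (d - 1 - t) := mul_pos ht (by linarith)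
  set c := t * (d - 1 - t) / 2
  have hlim : Tendsto (fun n : ℕ ↦ Real.exp (-(c * (p n * n)))) atTop (𝓝 0) :=
    Real.tendsto_exp_neg_atTop_nhds_zero.comp
      ((tendsto_mul_natCast_atTop hp).const_mul_atTop (half_pos hc))
  refine .of_real_le hlim ?_
  filter_upwards [eventually_ge_atTop 2] with n hn
  have hn2 : (2 : ℝ) ≤ n := by exact_mod_cast hn
  have hp0 := (p n).2.1
  -- The degree of one fixed vertex bounds the minimum degree, so no union bound is needed.
  have x : Fin n := ⟨0, by omega⟩
  have h := binomialRandom_real_upper_tail (p n) (pairsAt_subset_pairs x) (d := d) ht.le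
    (min_le_left _ _)
  rw [card_pairsAt, Fintype.card_fin, Nat.cast_sub (by omega), Nat.cast_one] at h
  refine (measureReal_mono fun Γ hΓ ↦ ?_).trans (h.trans (Real.exp_le_exp.2 ?_))
  · simp only [Set.mem_ofPred_eq, not_forall, not_lt, edgeCount_pairsAt] at hΓ ⊢
    obtain ⟨G, hG, hle⟩ := hΓ
    have hdeg : G.minDeg ≤ Γ.degree x := (G.minDegree_le_degree x).trans (degree_le_of_le hG)
    calc d * ((n - 1) * p n) ≤ d * p n * n := by
          nlinarith [mul_nonneg (zero_lt_one.trans hd).le hp0]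
      _ ≤ G.minDeg := hle
      _ ≤ _ := by exact_mod_cast hdeg
  · have : (p n : ℝ) * n / 2 ≤ (n - 1) * p n := by nlinarith
    have := mul_le_mul_of_nonneg_left this hc.le
    simp only [c]
    linarith

end Asymptotics

/-! ### The 2-density and the expected number of copies -/

section TwoDensity

/-- A subgraph attaining the 2-density. -/
theorem exists_subgraph_twoDensity_eq {W : Type*} [Finite W] (H : SimpleGraph W)
    (hH : 2 ≤ H.edgeSet.ncard) :
    0 < H.twoDensity ∧ ∃ F : H.Subgraph, 3 ≤ F.verts.ncard ∧
      H.twoDensity = ((F.edgeSet.ncard : ℝ) - 1) / ((F.verts.ncard : ℝ) - 2) := by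
  classical
  have := Fintype.ofFinite W
  -- Two edges need three vertices, so `⊤` is an admissible subgraph and the supremum is not over
  -- the empty set.
  have hW : 3 ≤ Nat.card W := by
    by_contra! hlt
    have h1 : H.edgeSet.ncard ≤ (Nat.card W).choose 2 := by
      rw [← coe_edgeFinset, Set.ncard_coe_finset, Nat.card_eq_fintype_card]
      exact H.card_edgeFinset_le_card_choose_two
    have h2 : (Nat.card W).choose 2 ≤ Nat.choose 2 2 := Nat.choose_le_choose 2 (by omega)
    rw [Nat.choose_self] at h2
    omega
  set X : Set ℝ := {x : ℝ | ∃ F : H.Subgraph, 3 ≤ F.verts.ncard ∧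
    x = ((F.edgeSet.ncard : ℝ) - 1) / ((F.verts.ncard : ℝ) - 2)}
  have hfin : X.Finite := by
    refine (Set.finite_range fun F : H.Subgraph ↦
      ((F.edgeSet.ncard : ℝ) - 1) / ((F.verts.ncard : ℝ) - 2)).subset ?_
    rintro _ ⟨F, -, rfl⟩
    exact ⟨F, rfl⟩
  have htop : ((H.edgeSet.ncard : ℝ) - 1) / ((Nat.card W : ℝ) - 2) ∈ X :=
    ⟨⊤, by simpa using hW, by simp⟩
  have hpos : 0 < ((H.edgeSet.ncard : ℝ) - 1) / ((Nat.card W : ℝ) - 2) := by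
    have h1 : (2 : ℝ) ≤ H.edgeSet.ncard := by exact_mod_cast hH
    have h2 : (3 : ℝ) ≤ Nat.card W := by exact_mod_cast hW
    exact div_pos (by linarith) (by linarith)
  refine ⟨hpos.trans_le (le_csSup hfin.bddAbove htop), ?_⟩
  exact Set.Nonempty.csSup_mem ⟨_, htop⟩ hfin

/-- Below the threshold `n ^ (-1 / m₂)`, a graph of 2-density `m₂` has fewer copies than edges. -/
lemma tendsto_pow_mul_pow_zero {p : ℕ → unitInterval} {v m : ℕ} (hv : 3 ≤ v) {δ : ℝ} (hδ : 0 < δ)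
    (hδ' : δ = ((m : ℝ) - 1) / ((v : ℝ) - 2))
    (hp : (fun n : ℕ => (p n : ℝ)) =o[atTop] (fun n : ℕ => (n : ℝ) ^ (-1 / δ))) :
    2 ≤ m ∧ Tendsto (fun n : ℕ ↦ (n : ℝ) ^ (v - 2) * (p n : ℝ) ^ (m - 1)) atTop (𝓝 0) := by
  have hv' : (0 : ℝ) < (v : ℝ) - 2 := by
    have : (3 : ℝ) ≤ v := by exact_mod_cast hv
    linarith
  have hm' : (0 : ℝ) < (m : ℝ) - 1 := by
    rw [hδ'] at hδ
    exact (div_pos_iff_of_pos_right hv').1 hδ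
  have hm : 2 ≤ m := by
    have : (1 : ℝ) < m := by linarith
    exact_mod_cast this
  refine ⟨hm, ?_⟩
  -- The little-o survives the power because m - 1 ≠ 0. The exponents then cancel, as (m - 1)/δ = v
  -- - 2.
  have hpow := (hp.pow (n := m - 1) (by omega))
  have hO : (fun n : ℕ ↦ (n : ℝ) ^ (v - 2)) =O[atTop] fun n : ℕ ↦ (n : ℝ) ^ (v - 2) :=
    isBigO_refl _ _
  have h := hO.mul_isLittleO hpow
  refine (isLittleO_one_iff ℝ).1 (h.congr' .rfl ?_)
  filter_upwards [eventually_gt_atTop 0] with n hn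
  have hn' : (0 : ℝ) < n := Nat.cast_pos.2 hn
  rw [← Real.rpow_natCast, ← Real.rpow_natCast, ← Real.rpow_mul hn'.le, ← Real.rpow_add hn',
    Nat.cast_sub (by omega), Nat.cast_sub (by omega), hδ']
  convert Real.rpow_zero (n : ℝ) using 2
  push_cast
  field_simp
  ring

end TwoDensity

/-! ### The H-free subgraph and the chromatic threshold -/

section Threshold

variable {W : Type*} [Finite W] {H : SimpleGraph W} {p : ℕ → unitInterval}

/-- Below the 2-density threshold, one can destroy all copies of `H` in `G(n, p)` while keeping
almost all the edges at every vertex. -/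
theorem whp_exists_free_subgraph_lostNeighbors_le (hH : 2 ≤ H.edgeSet.ncard)
    (hp_lower : (fun n : ℕ => Real.log n / n) =o[atTop] (fun n : ℕ => (p n : ℝ)))
    (hp_upper : (fun n : ℕ => (p n : ℝ)) =o[atTop]
      (fun n : ℕ => (n : ℝ) ^ (-1 / H.twoDensity))) {c : ℝ} (hc : 0 < c) :
    Whp p fun n Γ ↦ ∃ G ≤ Γ, H.Free G ∧
      ∀ x, ((lostNeighbors Γ G x).card : ℝ) ≤ c * (p n * n) := by
  classical
  have := Fintype.ofFinite W
  obtain ⟨hpos, F, hF, hFeq⟩ := exists_subgraph_twoDensity_eq H hH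
  obtain ⟨hm, hη⟩ := tendsto_pow_mul_pow_zero hF hpos hFeq hp_upper
  have hv : Fintype.card F.verts = F.verts.ncard := by
    rw [← Nat.card_coe_set_eq, Nat.card_eq_fintype_card]
  have he : F.coe.edgeSet.ncard = F.edgeSet.ncard := by
    rw [← F.image_coe_edgeSet_coe,
      Set.ncard_image_of_injective _ (Sym2.map.injective Subtype.val_injective)]
  set m := F.edgeSet.ncard
  have hm0 : (0 : ℝ) < m := by exact_mod_cast (by omega : 0 < m)
  -- Each copy costs at most m edges at a vertex; the factor 2 absorbs the rounding up of the number
  -- of copies.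
  have hcm : 0 < c / (2 * m) := by positivity
  refine (whp_not_exists_disjoint_copies hp_lower F.coe (by omega) (by omega)
    (by rwa [hv, he]) hcm).mono ?_
  filter_upwards [(tendsto_mul_natCast_atTop hp_lower).eventually_ge_atTop (c / (2 * m))⁻¹]
    with n hn Γ hΓ
  obtain ⟨G, hG, hfree, hlost⟩ := exists_free_subgraph_lostNeighbors_le F.coe
    (Set.nonempty_of_ncard_ne_zero (by omega)) Γ _ hΓ
  refine ⟨G, hG, fun hcon ↦ hfree (IsContained.trans ⟨⟨F.hom, F.hom_injective⟩⟩ hcon), fun x ↦ ?_⟩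
  have h1 : ((lostNeighbors Γ G x).card : ℝ) ≤ ⌈c / (2 * m) * (p n * n)⌉₊ * m := by
    have := hlost x
    rw [he] at this
    exact_mod_cast this
  have h2 : 1 ≤ c / (2 * m) * (p n * n) := by
    rwa [inv_le_iff_one_le_mul₀' hcm] at hn
  have h3 := (Nat.ceil_lt_add_one (zero_le_one.trans h2)).le
  calc ((lostNeighbors Γ G x).card : ℝ) ≤ ⌈c / (2 * m) * (p n * n)⌉₊ * m := h1
    _ ≤ 2 * (c / (2 * m) * (p n * n)) * m := by gcongr; linarith
    _ = c * (p n * n) := by field_simp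

theorem whp_exists_free_subgraph_minDeg_chi (hH : 2 ≤ H.edgeSet.ncard)
    (hp_lower : (fun n : ℕ => Real.log n / n) =o[atTop] (fun n : ℕ => (p n : ℝ)))
    (hp_upper : (fun n : ℕ => (p n : ℝ)) =o[atTop]
      (fun n : ℕ => (n : ℝ) ^ (-1 / H.twoDensity))) {γ : ℝ} (hγ : 0 < γ) :
    Whp p fun n Γ ↦ ∃ G : SimpleGraph (Fin n), G ≤ Γ ∧ H.Free G ∧
        (1 - 2 * γ) * (p n : ℝ) * n ≤ (G.minDeg : ℝ) ∧
        1 / 2 * γ ^ (-1 / 2 : ℝ) ≤ (G.chi : ℝ) := by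
  classical
  -- With a = 2√γ, the bound 1/a is the required ½γ^{-1/2}. Losing at most min(γ, a/8)·pn edges per
  -- vertex serves both claims; the other γ in the degree bound comes from concentration.
  have ha : 0 < 2 * √γ := by positivity
  have hc : 0 < min γ (2 * √γ / 8) := lt_min hγ (by positivity)
  refine ((whp_exists_free_subgraph_lostNeighbors_le hH hp_lower hp_upper hc).and
    ((whp_le_degree hp_lower hγ).and (whp_lt_edgeCount_pairsIn hp_lower ha))).mono ?_
  filter_upwards [eventually_gt_atTop 0] with n hn Γ hΓ
  obtain ⟨⟨G, hG, hfree, hlost⟩, hdeg, hI⟩ := hΓ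
  have hpn : 0 ≤ (p n : ℝ) * n := mul_nonneg (p n).2.1 (Nat.cast_nonneg n)
  refine ⟨G, hG, hfree, ?_, ?_⟩
  · have : Nonempty (Fin n) := ⟨⟨0, hn⟩⟩
    obtain ⟨x, hx⟩ := G.exists_minimal_degree_vertex
    have h1 : (Γ.degree x : ℝ) ≤ G.degree x + (lostNeighbors Γ G x).card := by
      exact_mod_cast degree_le_degree_add_card_lostNeighbors Γ G x
    have h2 := mul_le_mul_of_nonneg_right (min_le_left γ (2 * √γ / 8)) hpn
    have h3 : G.minDeg = G.degree x := by rw [minDeg, ← hx]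
    rw [h3]
    linarith [hdeg x, hlost x]
  · have h := one_le_mul_chi Γ G hn (a := 2 * √γ) (L := p n * n * (2 * √γ / 8))
      (fun x ↦ (hlost x).trans ?_) fun I hle ↦ ?_
    · rw [show (-1 / 2 : ℝ) = -(1 / 2) by norm_num, Real.rpow_neg hγ.le, ← Real.sqrt_eq_rpow]
      have hs : 0 < √γ := Real.sqrt_pos.2 hγ
      rw [← div_eq_mul_inv, div_le_iff₀ hs]
      linarith
    · rw [mul_comm]
      exact mul_le_mul_of_nonneg_left (min_le_right _ _) hpn
    · rw [mul_comm]
      exact hI I hle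

/-- Every d > 1 is admissible vacuously, and no d < 1 is admissible by the first part. Whether d = 1
is admissible does not affect the infimum. -/
theorem chromaticThreshold_eq_one (hH : 2 ≤ H.edgeSet.ncard)
    (hp_lower : (fun n : ℕ => Real.log n / n) =o[atTop] (fun n : ℕ => (p n : ℝ)))
    (hp_upper : (fun n : ℕ => (p n : ℝ)) =o[atTop]
      (fun n : ℕ => (n : ℝ) ^ (-1 / H.twoDensity))) :
    H.chromaticThreshold p = 1 := by
  have hmem : ∀ d : ℝ, 1 < d → d ∈ {d : ℝ | 0 < d ∧ ∃ C : ℝ, 0 < C ∧ Whp p fun n Γ =>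
      ∀ G : SimpleGraph (Fin n), G ≤ Γ → H.Free G → d * (p n : ℝ) * n ≤ (G.minDeg : ℝ) →
        (G.chi : ℝ) ≤ C} := by
    intro d hd
    refine ⟨zero_lt_one.trans hd, 1, one_pos, (whp_minDeg_lt hp_lower hd).mono ?_⟩
    exact .of_forall fun n Γ hΓ G hG _ hdeg ↦ absurd hdeg (hΓ G hG).not_ge
  refine csInf_eq_of_forall_ge_of_forall_gt_exists_lt ⟨2, hmem 2 one_lt_two⟩ ?_ ?_
  · rintro d ⟨-, C, hC, hwhp⟩
    by_contra! hd
    -- The first bound gives d ≤ 1 - 2γ, the second ½γ^{-1/2} ≥ 2C > C. Two events holding whp then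
    -- contradict each other.
    have hγ : 0 < min ((1 - d) / 2) ((4 * C) ^ 2)⁻¹ := lt_min (by linarith) (by positivity)
    set γ := min ((1 - d) / 2) ((4 * C) ^ 2)⁻¹
    refine not_whp_false
      ((hwhp.and (whp_exists_free_subgraph_minDeg_chi hH hp_lower hp_upper hγ)).mono ?_)
    refine .of_forall fun n Γ ⟨h1, G, hG, hfree, hdeg, hchi⟩ ↦ ?_
    have hγd : γ ≤ (1 - d) / 2 := min_le_left _ _
    have hdeg' : d * (p n : ℝ) * n ≤ (G.minDeg : ℝ) := by
      refine le_trans ?_ hdeg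
      have := (p n).2.1
      gcongr
      linarith
    have hup := h1 G hG hfree hdeg'
    have hroot : 4 * C ≤ γ ^ (-1 / 2 : ℝ) := by
      calc 4 * C = (((4 * C) ^ 2)⁻¹) ^ (-1 / 2 : ℝ) := by
            rw [Real.inv_rpow (by positivity), ← Real.rpow_neg (by positivity),
              ← Real.rpow_natCast, ← Real.rpow_mul (by positivity)]
            norm_num
        _ ≤ γ ^ (-1 / 2 : ℝ) :=
            Real.rpow_le_rpow_of_nonpos hγ (min_le_right _ _) (by norm_num)
    linarith
  · intro w hw
    obtain ⟨d, hd, hdw⟩ := exists_between hw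
    exact ⟨d, hmem d hd, hdw⟩

end Threshold

end SimpleGraph

theorem proposition3p2 {W : Type*} [Finite W] (H : SimpleGraph W) (hH : 2 ≤ H.edgeSet.ncard)
    (p : ℕ → unitInterval)
    (hp_lower : (fun n : ℕ => Real.log n / n) =o[atTop] (fun n : ℕ => (p n : ℝ)))
    (hp_upper : (fun n : ℕ => (p n : ℝ)) =o[atTop]
      (fun n : ℕ => (n : ℝ) ^ (-1 / H.twoDensity))) :
    (∀ γ : ℝ, 0 < γ → SimpleGraph.Whp p fun n Γ =>
      ∃ G : SimpleGraph (Fin n), G ≤ Γ ∧ H.Free G ∧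
        (1 - 2 * γ) * (p n : ℝ) * n ≤ (G.minDeg : ℝ) ∧
        1 / 2 * γ ^ (-1 / 2 : ℝ) ≤ (G.chi : ℝ)) ∧
    H.chromaticThreshold p = 1 :=
  ⟨fun _ hγ ↦ SimpleGraph.whp_exists_free_subgraph_minDeg_chi hH hp_lower hp_upper hγ,
    SimpleGraph.chromaticThreshold_eq_one hH hp_lower hp_upper⟩
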